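/- Let $\mathcal B$ be an AF $C^*$-algebra, that is, a unital $C^*$-algebra containing an increasing chain $\mathcal B_1\subseteq\mathcal B_2\subseteq\cdots$ of finite-dimensional $C^*$-subalgebras, all containing the unit $I$ of $\mathcal B$, with $\bigcup_k\mathcal B_k$ dense in $\mathcal B$. Let $\mathcal A$ be a canonical subalgebra of $\mathcal B$, that is, a norm-closed (not necessarily self-adjoint) subalgebra of $\mathcal B$ containing a canonical masa of $\mathcal B$. Here a canonical masa is a subalgebra of the form $\mathcal D=\overline{\bigcup_k\mathcal D_k}$, where, for some chain $(\mathcal B_k)$ as above, $\mathcal D_k$ is a maximal abelian self-adjoint subalgebra of $\mathcal B_k$, $\mathcal D_k\subseteq\mathcal D_{k+1}$, and every partial isometry $v\in\mathcal B_k$ with $v\mathcal D_kv^*\subseteq\mathcal D_k$ and $v^*\mathcal D_kv\subseteq\mathcal D_k$ also satisfies $v\mathcal D_{k+1}v^*\subseteq\mathcal D_{k+1}$ and $v^*\mathcal D_{k+1}v\subseteq\mathcal D_{k+1}$. Let $m,n,l\ge 0$ be integers with $m+l\ge 1$ and $n+l\ge 1$, and let $\delta:\mathcal A\to\mathcal B$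 be a bounded linear map which is an $(m,n,l)$-Jordan centralizer, i.e. $$(m+n+l)\,\delta(A^2)=m\,\delta(A)A+n\,A\delta(A)+l\,A\delta(I)A\qquad\text{for every }A\in\mathcal A.$$ Then $\delta$ is a centralizer, i.e. $\delta(AB)=\delta(A)B=A\delta(B)$ for all $A,B\in\mathcal A$. -/

import Mathlib

/-- `B : ℕ → StarSubalgebra ℂ 𝓑` is an increasing chain of finite-dimensional unital
C*-subalgebras of `𝓑` with dense union. (Star subalgebras contain the unit of `𝓑`, and
finite-dimensional ones are automatically norm closed.) -/
structure IsAFChain {𝓑 : Type*} [CStarAlgebra 𝓑] (B : ℕ → StarSubalgebra ℂ 𝓑) : Prop where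
  le_succ : ∀ k, B k ≤ B (k + 1)
  finiteDimensional : ∀ k, FiniteDimensional ℂ (B k)
  dense : Dense (⋃ k, (B k : Set 𝓑))

/-- A unital C*-algebra is approximately finite (AF) if it has a chain as above. -/
def IsAF (𝓑 : Type*) [CStarAlgebra 𝓑] : Prop :=
  ∃ B : ℕ → StarSubalgebra ℂ 𝓑, IsAFChain B

/-- `D` is a masa (maximal abelian self-adjoint subalgebra) of the C*-subalgebra `C`. -/
def IsMasaIn {𝓑 : Type*} [CStarAlgebra 𝓑] (D C : StarSubalgebra ℂ 𝓑) : Prop :=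
  Maximal (fun E : StarSubalgebra ℂ 𝓑 => E ≤ C ∧ ∀ x ∈ E, ∀ y ∈ E, x * y = y * x) D

/-- The partial isometries `v` of `C` which normalize `D`:
`v D v* ⊆ D` and `v* D v ⊆ D`. -/
def partialIsometryNormalizer {𝓑 : Type*} [CStarAlgebra 𝓑] (D C : StarSubalgebra ℂ 𝓑) :
    Set 𝓑 :=
  {v | v ∈ C ∧ v * star v * v = v ∧ ∀ d ∈ D, v * d * star v ∈ D ∧ star v * d * v ∈ D}

/-- `D` is a canonical masa of the AF C*-algebra `𝓑`: the closed union of masas `D k` of the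
members `B k` of some chain of finite-dimensional subalgebras with dense union, where `D k`
increases with `k` and the partial isometries of `B k` normalizing `D k` (equivalently, the
matrix units of `B k` relative to `D k`) normalize `D (k + 1)` as well. -/
def IsCanonicalMasa {𝓑 : Type*} [CStarAlgebra 𝓑] (D : StarSubalgebra ℂ 𝓑) : Prop :=
  ∃ B E : ℕ → StarSubalgebra ℂ 𝓑, IsAFChain B ∧
    (∀ k, IsMasaIn (E k) (B k)) ∧
    (∀ k, E k ≤ E (k + 1)) ∧
    (∀ k, partialIsometryNormalizer (E k) (B k) ⊆
      partialIsometryNormalizer (E (k + 1)) (B (k + 1))) ∧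
    (D : Set 𝓑) = closure (⋃ k, (E k : Set 𝓑))

/-- A canonical subalgebra of `𝓑`: a norm-closed (not necessarily self-adjoint) subalgebra
containing a canonical masa. -/
def IsCanonicalSubalgebra {𝓑 : Type*} [CStarAlgebra 𝓑] (A : Subalgebra ℂ 𝓑) : Prop :=
  IsClosed (A : Set 𝓑) ∧ ∃ D : StarSubalgebra ℂ 𝓑, IsCanonicalMasa D ∧ D.toSubalgebra ≤ A

/-- `δ : A → 𝓑` is an `(m, n, l)`-Jordan centralizer. -/
def IsJordanCentralizer {𝓑 : Type*} [CStarAlgebra 𝓑] {A : Subalgebra ℂ 𝓑} (m n l : ℕ)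
    (δ : A →ₗ[ℂ] 𝓑) : Prop :=
  m + n + l ≠ 0 ∧ ∀ a : A, (m + n + l) • δ (a * a) =
    m • (δ a * (a : 𝓑)) + n • ((a : 𝓑) * δ a) + l • ((a : 𝓑) * δ 1 * (a : 𝓑))

/-- `δ : A → 𝓑` is a left and a right centralizer. -/
def IsCentralizer {𝓑 : Type*} [CStarAlgebra 𝓑] {A : Subalgebra ℂ 𝓑} (δ : A →ₗ[ℂ] 𝓑) : Prop :=
  (∀ a b : A, δ (a * b) = δ a * (b : 𝓑)) ∧ ∀ a b : A, δ (a * b) = (a : 𝓑) * δ b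

/-! Put T = δ(1). Polarizing the identity at a + 1 makes δ(a) a weighted mean of Ta and aT
(`IsJordanCentralizer.smul_apply`). Substituting this back yields Ta² + a²T = 2aTa, that is [a, [a,
T]] = 0, so it remains to show that T commutes with A (`IsCanonicalSubalgebra.commute_of_jordan`).
The identity makes T commute with every idempotent of A, hence with the masa, which contains its own
commutant; so T is a limit of elements y of the E k. For a projection p in E k, the idempotents p +
pa(1 - p) show that T commutes with the off-diagonal corners of a, so [a, T] commutes with E k. A
contractive expectation F onto the commutant of E k fixes [a, T] and kills [a, y], so ‖[a, T]‖ ≤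
2‖a‖‖T - y‖, which is arbitrarily small. -/

/-- A finite-dimensional C*-algebra is spanned by its projections. -/
theorem span_isStarProjection_eq_top (C : Type*) [CStarAlgebra C] [FiniteDimensional ℂ C] :
    Submodule.span ℂ {p : C | IsStarProjection p} = ⊤ := by
  have key : ∀ a : C, IsSelfAdjoint a → a ∈ Submodule.span ℂ {p : C | IsStarProjection p} := by
    intro a ha
    have hfin : (spectrum ℝ a).Finite := by
      have : FiniteDimensional ℝ C := FiniteDimensional.complexToReal C
      have hint : IsIntegral ℝ a := Algebra.IsIntegral.isIntegral a
      refine (Polynomial.finite_setOfPred_isRoot (minpoly.ne_zero hint)).subset fun r hr => ?_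
      by_contra h0
      have h := spectrum.subset_polynomial_aeval a (minpoly ℝ a) ⟨r, hr, rfl⟩
      rw [minpoly.aeval, spectrum.mem_iff, sub_zero] at h
      exact h ((IsUnit.mk0 _ h0).map (algebraMap ℝ C))
    -- On a finite spectrum even indicators of points are continuous; they give the spectral
    -- projections of a.
    have hcont : ∀ f : ℝ → ℝ, ContinuousOn f (spectrum ℝ a) := fun f => hfin.continuousOn f
    have hsum : a = ∑ r ∈ hfin.toFinset, (r : ℂ) • cfc (fun x : ℝ => if x = r then (1 : ℝ) else 0) a := by
      have h1 : cfc (∑ r ∈ hfin.toFinset, fun x : ℝ => r • (if x = r then (1 : ℝ) else 0)) a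
          = a := by
        conv_rhs => rw [← cfc_id' ℝ a]
        apply cfc_congr
        intro x hx
        simp [Finset.sum_apply, hx]
      conv_lhs => rw [← h1]
      rw [cfc_sum _ _ _ fun _ _ => hcont _]
      refine Finset.sum_congr rfl fun r _ => ?_
      rw [cfc_smul _ _ _ (hcont _), Complex.coe_smul]
    rw [hsum]
    refine Submodule.sum_mem _ fun r _ => Submodule.smul_mem _ _ (Submodule.subset_span ?_)
    refine ⟨?_, cfc_predicate _ a⟩
    rw [IsIdempotentElem, ← cfc_mul _ _ a (hcont _) (hcont _)]
    congr 1
    ext x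
    split_ifs <;> simp
  rw [eq_top_iff]
  intro a _
  rw [← realPart_add_I_smul_imaginaryPart a]
  exact add_mem (key _ (realPart a).2) (Submodule.smul_mem _ _ (key _ (imaginaryPart a).2))

section

variable {𝓑 : Type*} [CStarAlgebra 𝓑]

/-- A finite-dimensional star subalgebra is spanned by finitely many projections. -/
theorem exists_finset_isStarProjection_span (E : StarSubalgebra ℂ 𝓑) [FiniteDimensional ℂ E] :
    ∃ s : Finset 𝓑, (∀ p ∈ s, IsStarProjection p ∧ p ∈ E) ∧
      ∀ d ∈ E, d ∈ Submodule.span ℂ (s : Set 𝓑) := by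
  have hclosed : IsClosed (E : Set 𝓑) :=
    Submodule.closed_of_finiteDimensional (Subalgebra.toSubmodule E.toSubalgebra)
  have hspan := span_isStarProjection_eq_top E
  obtain ⟨t, ht, hts⟩ := Submodule.fg_span_iff_fg_span_finset_subset
    {p : E | IsStarProjection p} |>.1 (hspan ▸ Module.Finite.fg_top)
  classical
  refine ⟨t.image (fun x : E => (x : 𝓑)), ?_, ?_⟩
  · intro p hp
    obtain ⟨q, hq, rfl⟩ := Finset.mem_image.1 hp
    exact ⟨(ht hq).map E.subtype, q.2⟩
  · intro d hd
    have h : (⟨d, hd⟩ : E) ∈ Submodule.span ℂ (t : Set E) := by rw [← hts, hspan]; trivial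
    have := Submodule.mem_map_of_mem (f := E.subtype.toAlgHom.toLinearMap) h
    rw [Submodule.map_span] at this
    simpa using this

/-! ### Expectations onto commutants -/

/-- A contractive projection onto the commutant of a commuting family of projections. -/
theorem exists_contractive_pinching (s : Finset 𝓑) (hs : ∀ p ∈ s, IsStarProjection p)
    (hcomm : ∀ p ∈ s, ∀ q ∈ s, Commute p q) :
    ∃ F : 𝓑 →ₗ[ℂ] 𝓑, (∀ x, ‖F x‖ ≤ ‖x‖) ∧ (∀ x, ∀ p ∈ s, Commute p (F x)) ∧
      (∀ y, (∀ p ∈ s, Commute p y) → ∀ x, F (y * x) = y * F x ∧ F (x * y) = F x * y) ∧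
      F 1 = 1 ∧ ∀ C : StarSubalgebra ℂ 𝓑, (s : Set 𝓑) ⊆ C → ∀ x ∈ C, F x ∈ C := by
  classical
  induction s using Finset.induction_on with
  | empty => exact ⟨LinearMap.id, by simp⟩
  | insert p s hps ih =>
    simp only [Finset.forall_mem_insert] at hs hcomm
    obtain ⟨F, hF, hFs, hFy, hF1, hFC⟩ := ih hs.2 fun q hq r hr => (hcomm.2 q hq).2 r hr
    have hp : p * p = p := hs.1.isIdempotentElem
    have hp' : ∀ x, p * (p * x) = p * x := fun x => by rw [← mul_assoc, hp]
    let G : 𝓑 →ₗ[ℂ] 𝓑 :=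
      LinearMap.mulLeftRight ℂ (p, p) + LinearMap.mulLeftRight ℂ (1 - p, 1 - p)
    have hG : ∀ x, G x = p * x * p + (1 - p) * x * (1 - p) := fun x => by simp [G]
    have hGx : ∀ x, ‖G x‖ ≤ ‖x‖ := by
      intro x
      have hu : 2 * p - 1 ∈ unitary 𝓑 := hs.1.two_mul_sub_one_mem_unitary
      -- The pinching averages x with its conjugate by the self-adjoint unitary 2p - 1, hence is
      -- contractive.
      have h : G x = (2⁻¹ : ℂ) • (x + (2 * p - 1) * x * (2 * p - 1)) := by
        rw [hG, eq_inv_smul_iff₀ two_ne_zero, two_smul]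
        noncomm_ring
      rw [h, norm_smul]
      have h2 : ‖(2 * p - 1) * x * (2 * p - 1)‖ = ‖x‖ := by
        rw [CStarRing.norm_mul_mem_unitary _ hu, CStarRing.norm_mem_unitary_mul _ hu]
      have := norm_add_le x ((2 * p - 1) * x * (2 * p - 1))
      simp only [norm_inv, Complex.norm_ofNat]
      linarith
    refine ⟨G ∘ₗ F, fun x => (hGx _).trans (hF x), ?_, ?_, ?_, ?_⟩
    · intro x q hq
      rw [LinearMap.comp_apply, hG]
      rcases Finset.mem_insert.1 hq with rfl | hq
      · change _ * _ = _ * _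
        simp only [mul_add, add_mul, mul_sub, sub_mul, mul_one, one_mul, mul_assoc, hp, hp']
        abel
      · have h1 : Commute q p := (hcomm.2 q hq).1
        have h2 := hFs x q hq
        have h3 : Commute q (1 - p) := (Commute.one_right q).sub_right h1
        exact ((h1.mul_right h2).mul_right h1).add_right ((h3.mul_right h2).mul_right h3)
    · intro y hy x
      simp only [Finset.forall_mem_insert] at hy
      have h1 : p * y = y * p := hy.1
      have h2 : ∀ z, p * (y * z) = y * (p * z) := fun z => by
        rw [← mul_assoc, h1, mul_assoc]
      simp only [LinearMap.comp_apply, (hFy y hy.2 x).1, (hFy y hy.2 x).2, hG]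
      constructor <;>
      · simp only [mul_add, add_mul, mul_sub, sub_mul, mul_one, one_mul, mul_assoc, h1, h2]
    · rw [LinearMap.comp_apply, hF1, hG]
      simp only [mul_sub, sub_mul, mul_one, one_mul, hp]
      abel
    · intro C hC x hx
      rw [Finset.coe_insert, Set.insert_subset_iff] at hC
      have hx' := hFC C hC.2 x hx
      have hpC : p ∈ C := hC.1
      rw [LinearMap.comp_apply, hG]
      exact add_mem (mul_mem (mul_mem hpC hx') hpC)
        (mul_mem (mul_mem (sub_mem (one_mem C) hpC) hx') (sub_mem (one_mem C) hpC))

/-- A contractive projection onto the commutant of a finite-dimensional abelian subalgebra. -/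
theorem exists_contractive_expectation (E : StarSubalgebra ℂ 𝓑) [FiniteDimensional ℂ E]
    (hE : ∀ x ∈ E, ∀ y ∈ E, x * y = y * x) :
    ∃ F : 𝓑 →ₗ[ℂ] 𝓑, (∀ x, ‖F x‖ ≤ ‖x‖) ∧ (∀ x, ∀ d ∈ E, Commute d (F x)) ∧
      (∀ y, (∀ d ∈ E, Commute d y) → ∀ x, F (y * x) = y * F x ∧ F (x * y) = F x * y) ∧
      F 1 = 1 ∧ ∀ C : StarSubalgebra ℂ 𝓑, E ≤ C → ∀ x ∈ C, F x ∈ C := by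
  obtain ⟨s, hs, hspan⟩ := exists_finset_isStarProjection_span E
  obtain ⟨F, h1, h2, h3, h4, h5⟩ := exists_contractive_pinching s (fun p hp => (hs p hp).1)
    fun p hp q hq => hE p (hs p hp).2 q (hs q hq).2
  refine ⟨F, h1, fun x d hd => ?_, fun y hy => h3 y fun p hp => hy p (hs p hp).2, h4,
    fun C hC => h5 C fun p hp => hC (hs p hp).2⟩
  have : Submodule.span ℂ (s : Set 𝓑) ≤
      Subalgebra.toSubmodule (Subalgebra.centralizer ℂ {F x}) := by
    refine Submodule.span_le.2 fun p hp => ?_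
    simpa [Set.mem_centralizer_iff] using (h2 x p hp).symm.eq
  have := this (hspan d hd)
  simp only [Subalgebra.mem_toSubmodule, Subalgebra.mem_centralizer_iff] at this
  exact (this _ rfl).symm

/-- An element commuting with all projections of a finite-dimensional star subalgebra commutes
with the subalgebra. -/
theorem commute_of_commute_isStarProjection (E : StarSubalgebra ℂ 𝓑) [FiniteDimensional ℂ E]
    {y : 𝓑} (hy : ∀ p ∈ E, IsStarProjection p → Commute p y) : ∀ d ∈ E, Commute d y := by
  obtain ⟨s, hs, hspan⟩ := exists_finset_isStarProjection_span E
  intro d hd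
  have : Submodule.span ℂ (s : Set 𝓑) ≤
      Subalgebra.toSubmodule (Subalgebra.centralizer ℂ {y}) := by
    refine Submodule.span_le.2 fun p hp => ?_
    simpa [Set.mem_centralizer_iff] using (hy p (hs p hp).2 (hs p hp).1).symm.eq
  have := this (hspan d hd)
  simp only [Subalgebra.mem_toSubmodule, Subalgebra.mem_centralizer_iff] at this
  exact (this _ rfl).symm

/-! ### Masas and their commutants -/

/-- A masa contains every element of the ambient subalgebra commuting with it. -/
theorem IsMasaIn.mem_of_commute {D C : StarSubalgebra ℂ 𝓑} (h : IsMasaIn D C) {x : 𝓑}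
    (hx : x ∈ C) (hcomm : ∀ d ∈ D, Commute d x) : x ∈ D := by
  have key : ∀ a ∈ C, IsSelfAdjoint a → (∀ d ∈ D, Commute d a) → a ∈ D := by
    intro a haC ha hda
    -- Adjoining a to D keeps the algebra abelian and inside C, so maximality applies.
    let S : Set 𝓑 := insert a (D : Set 𝓑)
    have hSD : ∀ y ∈ S, ∀ z ∈ S, y * z = z * y := by
      rintro y (rfl | hy) z (rfl | hz)
      · rfl
      · exact (hda z hz).symm
      · exact hda y hy
      · exact h.prop.2 y hy z hz
    have hSs : ∀ y ∈ S, ∀ z ∈ S, y * star z = star z * y := by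
      rintro y hy z (rfl | hz)
      · rw [ha.star_eq]; exact hSD y hy _ (Or.inl rfl)
      · exact hSD y hy _ (Or.inr (star_mem hz))
    have hle : D ≤ StarAlgebra.adjoin ℂ S := fun d hd =>
      StarAlgebra.subset_adjoin ℂ S (Or.inr hd)
    refine h.le_of_ge ⟨?_, ?_⟩ hle (StarAlgebra.subset_adjoin ℂ S (Or.inl rfl))
    · refine StarAlgebra.adjoin_le ?_
      rintro y (rfl | hy)
      · exact haC
      · exact h.prop.1 hy
    · intro y hy z hz
      have := StarAlgebra.isMulCommutative_adjoin ℂ hSD hSs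
      exact setLike_mul_comm hy hz
  have hstar : ∀ d ∈ D, Commute d (star x) := fun d hd => by
    simpa using (hcomm (star d) (star_mem hd)).star_star
  rw [← realPart_add_I_smul_imaginaryPart x]
  have hreal : ∀ (c : ℝ) (y : 𝓑), c • y = (c : ℂ) • y := fun c y => (Complex.coe_smul c y).symm
  refine add_mem (key _ ?_ (realPart x).2 ?_) (D.smul_mem (key _ ?_ (imaginaryPart x).2 ?_) _)
  · rw [realPart_apply_coe, hreal]
    exact C.smul_mem (add_mem hx (star_mem hx)) _
  · intro d hd
    rw [realPart_apply_coe]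
    exact ((hcomm d hd).add_right (hstar d hd)).smul_right _
  · rw [imaginaryPart_apply_coe, hreal]
    exact C.smul_mem (C.smul_mem (sub_mem hx (star_mem hx)) _) _
  · intro d hd
    rw [imaginaryPart_apply_coe]
    exact (((hcomm d hd).sub_right (hstar d hd)).smul_right _).smul_right _

/-- A masa in a finite-dimensional star subalgebra is finite-dimensional. -/
theorem IsMasaIn.finiteDimensional {D C : StarSubalgebra ℂ 𝓑} (h : IsMasaIn D C)
    (hC : FiniteDimensional ℂ C) : FiniteDimensional ℂ D :=
  FiniteDimensional.of_injective (StarSubalgebra.inclusion h.prop.1).toAlgHom.toLinearMap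
    (StarSubalgebra.inclusion_injective h.prop.1)

/-- The closed union of masas of an AF chain contains its commutant. -/
theorem mem_closure_iUnion_of_commute {B E : ℕ → StarSubalgebra ℂ 𝓑} (hB : IsAFChain B)
    (hE : ∀ k, IsMasaIn (E k) (B k)) {x : 𝓑} (hx : ∀ k, ∀ d ∈ E k, Commute d x) :
    x ∈ closure (⋃ k, (E k : Set 𝓑)) := by
  rw [Metric.mem_closure_iff]
  intro ε hε
  obtain ⟨y, hy, hxy⟩ := Metric.mem_closure_iff.1 (hB.dense x) ε hε
  obtain ⟨k, hk⟩ := Set.mem_iUnion.1 hy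
  have := (hE k).finiteDimensional (hB.finiteDimensional k)
  obtain ⟨F, h1, h2, h3, h4, h5⟩ := exists_contractive_expectation (E k) (hE k).prop.2
  -- F y stays in B k and commutes with E k, so it lies in the masa E k.
  refine ⟨F y, Set.mem_iUnion.2 ⟨k, (hE k).mem_of_commute (h5 _ (hE k).prop.1 y hk) (h2 y)⟩, ?_⟩
  have hFx : F x = x := by simpa [h4] using (h3 x (hx k) 1).1
  rw [dist_eq_norm] at hxy ⊢
  calc ‖x - F y‖ = ‖F (x - y)‖ := by rw [map_sub, hFx]
    _ ≤ ‖x - y‖ := h1 _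
    _ < ε := hxy

/-! ### The Jordan identity forces commutation -/

/-- An idempotent `p` with `T p² + p² T = 2 p T p` commutes with `T`. -/
theorem IsIdempotentElem.commute_of_jordan {R : Type*} [Ring R] {p T : R}
    (hp : IsIdempotentElem p)
    (h : T * (p * p) + p * p * T = 2 * (p * T * p)) : Commute p T := by
  have hp2 : p * p = p := hp
  rw [hp2] at h
  have h1 : p * T = p * T * p := by
    have := congrArg (p * ·) h
    simp only [mul_add, two_mul, ← mul_assoc, hp2] at this
    simp only [add_mul] at this
    exact add_left_cancel this
  have h2 : T * p = p * T * p := by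
    have := congrArg (· * p) h
    simp only [add_mul, two_mul, mul_assoc, hp2] at this
    rw [mul_assoc]
    exact add_right_cancel this
  exact h1.trans h2.symm

/-- If `T` satisfies `T a² + a² T = 2 a T a` on a canonical subalgebra, it lies in the commutant
of that subalgebra. -/
theorem IsCanonicalSubalgebra.commute_of_jordan {A : Subalgebra ℂ 𝓑}
    (hA : IsCanonicalSubalgebra A) {T : 𝓑}
    (hT : ∀ a ∈ A, T * (a * a) + a * a * T = 2 * (a * T * a)) : ∀ a ∈ A, Commute a T := by
  obtain ⟨-, D, ⟨B, E, hB, hE, -, -, hD⟩, hDA⟩ := hA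
  have hEA : ∀ k, ∀ d ∈ E k, d ∈ A := fun k d hd =>
    hDA (show d ∈ (D : Set 𝓑) from hD ▸ subset_closure (Set.mem_iUnion.2 ⟨k, hd⟩))
  have hfd := fun k => (hE k).finiteDimensional (hB.finiteDimensional k)
  have hidem : ∀ p ∈ A, IsIdempotentElem p → Commute p T := fun p hpA hp =>
    hp.commute_of_jordan (hT p hpA)
  have hTE : ∀ k, ∀ d ∈ E k, Commute d T := fun k =>
    commute_of_commute_isStarProjection (E k) fun p hp hpp =>
      hidem p (hEA k p hp) hpp.isIdempotentElem
  have hTD := mem_closure_iUnion_of_commute hB hE hTE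
  have hcorner : ∀ p ∈ A, IsIdempotentElem p → ∀ a ∈ A, Commute (p * a * (1 - p)) T := by
    intro p hpA hp a haA
    have hp2 : p * p = p := hp
    have hp3 : ∀ x, p * (p * x) = p * x := fun x => by rw [← mul_assoc, hp2]
    have h := hidem (p + p * a * (1 - p))
      (add_mem hpA (mul_mem (mul_mem hpA haA) (sub_mem (one_mem A) hpA))) (by
        rw [IsIdempotentElem]
        simp only [mul_add, add_mul, mul_sub, sub_mul, mul_one, mul_assoc, hp2, hp3]
        abel)
    simpa using h.sub_left (hidem p hpA hp)
  intro a haA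
  have hcE : ∀ k, ∀ d ∈ E k, Commute d (a * T - T * a) := fun k =>
    commute_of_commute_isStarProjection (E k) fun p hp hpp => by
      have hpA := hEA k p hp
      have hpi := hpp.isIdempotentElem
      have hp2 : p * p = p := hpi
      have hp3 : ∀ x, p * (p * x) = p * x := fun x => by rw [← mul_assoc, hp2]
      have hpT : p * T = T * p := hidem p hpA hpi
      have hpT' : ∀ x, p * (T * x) = T * (p * x) := fun x => by
        rw [← mul_assoc, hpT, mul_assoc]
      have h1 : p * a * (1 - p) * T = T * (p * a * (1 - p)) := hcorner p hpA hpi a haA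
      have h2 : (1 - p) * a * (1 - (1 - p)) * T = T * ((1 - p) * a * (1 - (1 - p))) :=
        hcorner (1 - p) (sub_mem (one_mem A) hpA) hpi.one_sub a haA
      simp only [sub_sub_cancel, mul_sub, sub_mul, mul_one, one_mul, mul_assoc, hpT] at h1 h2
      change p * (a * T - T * a) = (a * T - T * a) * p
      simp only [mul_sub, sub_mul, mul_assoc, hpT']
      -- Both p[a, T] and [a, T]p equal p[a, T]p, since the two off-diagonal corners of a commute
      -- with T.
      have h3 : p * (a * T) - T * (p * a) = p * (a * (T * p)) - T * (p * (a * p)) := by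
        linear_combination (norm := module) h1
      have h4 : a * (T * p) - T * (a * p) = p * (a * (T * p)) - T * (p * (a * p)) := by
        linear_combination (norm := module) h2
      rw [h3, h4]
  have hsmall : ∀ ε > 0, ‖a * T - T * a‖ ≤ ε * (2 * ‖a‖) := by
    intro ε hε
    obtain ⟨y, hy, hTy⟩ := Metric.mem_closure_iff.1 hTD ε hε
    obtain ⟨k, hk⟩ := Set.mem_iUnion.1 hy
    have := hfd k
    obtain ⟨F, h1, h2, h3, h4, -⟩ := exists_contractive_expectation (E k) (hE k).prop.2
    have hFc : F (a * T - T * a) = a * T - T * a := by simpa [h4] using (h3 _ (hcE k) 1).1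
    have hyE : ∀ d ∈ E k, Commute d y := fun d hd => (hE k).prop.2 d hd y hk
    -- As y lies in the abelian E k, it can be pulled out of F, leaving [F a, y] = 0.
    have hFy : F (a * y - y * a) = 0 := by
      rw [map_sub, (h3 y hyE a).1, (h3 y hyE a).2, (h2 a y hk).eq, sub_self]
    rw [dist_eq_norm] at hTy
    calc ‖a * T - T * a‖ = ‖F (a * T - T * a) - F (a * y - y * a)‖ := by rw [hFc, hFy, sub_zero]
      _ = ‖F (a * (T - y) - (T - y) * a)‖ := by
        rw [← map_sub]; congr 2; noncomm_ring
      _ ≤ ‖a * (T - y) - (T - y) * a‖ := h1 _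
      _ ≤ ‖a‖ * ‖T - y‖ + ‖T - y‖ * ‖a‖ :=
        (norm_sub_le _ _).trans (add_le_add (norm_mul_le _ _) (norm_mul_le _ _))
      _ = ‖T - y‖ * (2 * ‖a‖) := by ring
      _ ≤ ε * (2 * ‖a‖) := by gcongr
  have h0 : ‖a * T - T * a‖ ≤ 0 := by
    have ht : Filter.Tendsto (fun ε : ℝ => ε * (2 * ‖a‖)) (nhdsWithin 0 (Set.Ioi 0))
        (nhds (0 * (2 * ‖a‖))) :=
      ((continuous_id.mul continuous_const).tendsto 0).mono_left nhdsWithin_le_nhds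
    rw [zero_mul] at ht
    exact ge_of_tendsto ht (eventually_nhdsWithin_of_forall hsmall)
  exact sub_eq_zero.1 (norm_le_zero_iff.1 h0)

/-! ### Reduction to the value at 1 -/

/-- A Jordan centralizer is determined by its value at `1`. -/
theorem IsJordanCentralizer.smul_apply {A : Subalgebra ℂ 𝓑} {m n l : ℕ} {δ : A →ₗ[ℂ] 𝓑}
    (hδ : IsJordanCentralizer m n l δ) (a : A) :
    ((m : ℂ) + n + 2 * l) • δ a = ((m : ℂ) + l) • (δ 1 * a) + ((n : ℂ) + l) • (a * δ 1) := by
  have h1 := hδ.2 (a + 1)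
  have h2 := hδ.2 a
  have h3 : (a + 1) * (a + 1) = a * a + a + a + 1 := by noncomm_ring
  rw [h3] at h1
  simp only [map_add, ← Nat.cast_smul_eq_nsmul ℂ, Nat.cast_add, Subalgebra.coe_add,
    Subalgebra.coe_one, mul_add, add_mul, mul_one, one_mul] at h1 h2
  linear_combination (norm := module) h1 - h2

/-- The value at `1` of a Jordan centralizer satisfies a Jordan-type identity. -/
theorem IsJordanCentralizer.jordan_apply_one {A : Subalgebra ℂ 𝓑} {m n l : ℕ} {δ : A →ₗ[ℂ] 𝓑}
    (hδ : IsJordanCentralizer m n l δ) (hml : 1 ≤ m + l) (hnl : 1 ≤ n + l) (a : A) :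
    δ 1 * ((a : 𝓑) * a) + (a : 𝓑) * a * δ 1 = 2 * (a * δ 1 * a) := by
  have h1 := hδ.2 a
  have h2 := hδ.smul_apply a
  have h3 := hδ.smul_apply (a * a)
  have hl := congrArg (· * (a : 𝓑)) h2
  have hr := congrArg ((a : 𝓑) * ·) h2
  simp only [← Nat.cast_smul_eq_nsmul ℂ, Nat.cast_add, Subalgebra.coe_mul, mul_add, add_mul,
    smul_mul_assoc, mul_smul_comm, mul_assoc] at h1 h3 hl hr ⊢
  -- After eliminating δ(a) and δ(a²), the whole identity carries this common factor; both lower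
  -- bounds are needed to cancel it.
  have hc : ((m : ℂ) + l) * (n + l) ≠ 0 := by
    norm_cast
    exact Nat.mul_ne_zero (by omega) (by omega)
  rw [← sub_eq_zero, ← smul_eq_zero_iff_right hc, two_mul]
  linear_combination (norm := module) ((m : ℂ) + n + 2 * l) • h1 - ((m : ℂ) + n + l) • h3
    + (m : ℂ) • hl + (n : ℂ) • hr

end

theorem theorem3p8 {𝓑 : Type*} [CStarAlgebra 𝓑] (h𝓑 : IsAF 𝓑)
    (A : Subalgebra ℂ 𝓑) (hA : IsCanonicalSubalgebra A)
    (m n l : ℕ) (hml : 1 ≤ m + l) (hnl : 1 ≤ n + l)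
    (δ : A →L[ℂ] 𝓑) (hδ : IsJordanCentralizer m n l (δ : A →ₗ[ℂ] 𝓑)) :
    IsCentralizer (δ : A →ₗ[ℂ] 𝓑) := by
  have hcomm : ∀ a ∈ A, Commute a (δ 1) := hA.commute_of_jordan fun a ha =>
    hδ.jordan_apply_one hml hnl ⟨a, ha⟩
  have hc : (m : ℂ) + n + 2 * l ≠ 0 := by
    norm_cast
    omega
  have hval : ∀ a : A, δ a = δ 1 * a := fun a => by
    have h : ((m : ℂ) + n + 2 * l) • δ a = _ := hδ.smul_apply a
    -- Once aT = Ta the weights m + l and n + l add up to m + n + 2l.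
    refine smul_right_injective 𝓑 hc (h.trans ?_)
    have ha : (a : 𝓑) * δ 1 = δ 1 * a := hcomm a a.2
    simp only [ContinuousLinearMap.coe_coe, ha]
    module
  refine ⟨fun a b => ?_, fun a b => ?_⟩
  · simp only [ContinuousLinearMap.coe_coe]
    rw [hval (a * b), hval a, Subalgebra.coe_mul, mul_assoc]
  · simp only [ContinuousLinearMap.coe_coe]
    rw [hval (a * b), hval b, Subalgebra.coe_mul, ← mul_assoc, ← mul_assoc, (hcomm a a.2).eq]
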